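/- **Theorem (Klein).** Let $K\subseteq\mathbb{C}$ be a subfield containing the fifth roots of unity, and let $L\subseteq\mathbb{C}$ be a Galois extension of $K$ with $\mathrm{Gal}(L/K)\cong A_5$. Let $L$ be the splitting field over $K$ of a monic quintic $g=x^5+c_4x^4+c_3x^3+c_2x^2+c_1x+c_0\in K[x]$, and let $z^5+pz^3+qz^2+rz+s$ be the quintic obtained from $g$ by the substitution $z=x+c_4/5$. If $p\neq 0$, suppose that $K$ contains the quadratic Tschirnhaus irrationality $\delta$ of $g$, that is, a square root of $$\delta^2=\frac{9q^2}{4p^2}+\frac{3p}{5}-\frac{2r}{p}$$ (if $p=0$, the quintic already has no terms of degree $4$ and $3$, and nothing is required). Put $$f(z,w)=zw(z^{10}+11z^5w^5-w^{10}),$$ $$H(z,w)=-(z^{20}+w^{20})+228(z^{15}w^5-z^5w^{15})-494z^{10}w^{10}.$$ Then there is $J\in K$ such that the icosahedral equation $$\frac{H(Y,1)^3}{1728\,f(Y,1)^5}=J$$ has a solution $Y\in\mathbb{C}$ (with $f(Y,1)\neq0$), and every such solution satisfies $L=K(Y)$, that is, $L$ is obtained from $K$ by adjoining $Y$. -/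

import Mathlib

open Polynomial

namespace Icosahedral

/-- The invariant binary form of degree 12 of the icosahedral group (zeros: the vertices),
`f(z, w) = z w (z¹⁰ + 11 z⁵ w⁵ - w¹⁰)`. -/
def formF {R : Type*} [CommRing R] (z w : R) : R :=
  z * w * (z ^ 10 + 11 * z ^ 5 * w ^ 5 - w ^ 10)

/-- The invariant binary form of degree 20 of the icosahedral group (zeros: the face centers),
the normalized Hessian of `formF`. -/
def formH {R : Type*} [CommRing R] (z w : R) : R :=
  -(z ^ 20 + w ^ 20) + 228 * (z ^ 15 * w ^ 5 - z ^ 5 * w ^ 15) - 494 * z ^ 10 * w ^ 10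

/-- `Y` is a (finite) solution of the icosahedral equation
`H(Y, 1)³ / (1728 f(Y, 1)⁵) = J`, the left-hand side being defined at `Y`. -/
def IsSolution (J Y : ℂ) : Prop :=
  formF Y 1 ≠ 0 ∧ formH Y 1 ^ 3 / (1728 * formF Y 1 ^ 5) = J

/-- For a monic quintic `g = x⁵ + c₄ x⁴ + ⋯ + c₀`, the quintic `z⁵ + p z³ + q z² + r z + s`
obtained from `g` by the substitution `z = x + c₄ / 5`. -/
noncomputable def depressed {F : Type*} [Field F] (g : F[X]) : F[X] :=
  g.comp (X - C (g.coeff 4 / 5))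

/-- `δ` is a quadratic Tschirnhaus irrationality of the monic quintic `g`: a square root of
`9 q² / (4 p²) + 3 p / 5 - 2 r / p`, where `z⁵ + p z³ + q z² + r z + s` is the depressed form
of `g` (to be used only for `p ≠ 0`). -/
def IsTschirnhausIrrationality {F : Type*} [Field F] (g : F[X]) (δ : F) : Prop :=
  let p := (depressed g).coeff 3
  let q := (depressed g).coeff 2
  let r := (depressed g).coeff 1
  δ ^ 2 = 9 * q ^ 2 / (4 * p ^ 2) + 3 * p / 5 - 2 * r / p

end Icosahedral

/-! A Tschirnhaus transformation over `K`, made possible by `δ`, sends the roots of `g` to `y i`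
with vanishing sum and vanishing sum of squares (`exists_principal_polynomial`). Such points form a
quadric surface, and the ratio `Y = -p₁ / p₂` of two Lagrange resolvents of the `y i` is a parameter
on one of its rulings. Even permutations of the `y i` preserve each ruling, so the Galois group acts
on `Y` by the Möbius transformations of the icosahedral group (`exists_generators_moebius`).

Hence the icosahedral invariant `J` of `Y` is fixed and lies in `K`. Also `K(Y)` is Galois over `K`,
so it is `K` or `L` because `A₅` is simple; no point of `K` is fixed by both generating
transformations, so it is `L` (`exists_primitive_invariant_mem`). Thus `Y` has degree 60, the degree
of the icosahedral equation. That equation is therefore irreducible, and its solutions are the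
conjugates of `Y`, each of which generates `L`. -/

namespace Icosahedral

/-! ### Invariance of the icosahedral function under two generating substitutions. -/

section Invariants

variable {F : Type*} [Field F]

/-- The substitution has determinant `-(φ² + 1)`, whose square is `5 φ²`. The form of degree 12 is
multiplied by its 6th power and the form of degree 20 by its 10th, so the factors cancel in `H³ /
f⁵`. -/
lemma formF_moebius {φ : F} (hφ : φ ^ 2 = φ + 1) (z : F) :
    formF (1 - φ * z) (z + φ) = 125 * φ ^ 6 * formF z 1 := by
  unfold formF
  grind

set_option maxRecDepth 20000 in
lemma formH_moebius {φ : F} (hφ : φ ^ 2 = φ + 1) (z : F) :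
    formH (1 - φ * z) (z + φ) = 3125 * φ ^ 10 * formH z 1 := by
  unfold formH
  grind

lemma formF_homogeneous {t : F} (ht : t ≠ 0) (z : F) :
    formF (z / t) 1 = formF z t / t ^ 12 := by
  unfold formF
  field_simp

lemma formH_homogeneous {t : F} (ht : t ≠ 0) (z : F) :
    formH (z / t) 1 = formH z t / t ^ 20 := by
  unfold formH
  field_simp

/-- The left-hand side of the icosahedral equation. -/
def invariant (z : F) : F := formH z 1 ^ 3 / (1728 * formF z 1 ^ 5)

lemma invariant_rotation {ζ : F} (hζ : ζ ^ 5 = 1) (z : F) :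
    invariant (ζ * z) = invariant z := by
  have hF : formF (ζ * z) 1 = ζ * formF z 1 := by
    unfold formF
    linear_combination (ζ * z ^ 11 * (ζ ^ 5 + 1) + 11 * ζ * z ^ 6) * hζ
  have hH : formH (ζ * z) 1 = formH z 1 := by
    unfold formH
    linear_combination (-z ^ 20 * (ζ ^ 15 + ζ ^ 10 + ζ ^ 5 + 1) +
      228 * z ^ 15 * (ζ ^ 10 + ζ ^ 5 + 1) - 228 * z ^ 5 - 494 * z ^ 10 * (ζ ^ 5 + 1)) * hζ
  rw [invariant, invariant, hF, hH, mul_pow, hζ, one_mul]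

lemma invariant_moebius [CharZero F] {φ : F} (hφ : φ ^ 2 = φ + 1) {z : F} (hz : z + φ ≠ 0) :
    invariant ((1 - φ * z) / (z + φ)) = invariant z := by
  have hφ0 : φ ≠ 0 := by
    rintro rfl
    norm_num at hφ
  rw [invariant, invariant, formF_homogeneous hz, formH_homogeneous hz, formF_moebius hφ,
    formH_moebius hφ]
  have h5 : (3125 * φ ^ 10 : F) ^ 3 = (125 * φ ^ 6) ^ 5 := by ring
  have h0 : (125 * φ ^ 6 : F) ^ 5 ≠ 0 :=
    pow_ne_zero _ (mul_ne_zero (by norm_num) (pow_ne_zero _ hφ0))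
  rw [div_pow, div_pow, mul_pow _ (formH z 1), mul_pow _ (formF z 1), h5, ← pow_mul, ← pow_mul,
    ← mul_div_assoc, div_div_div_cancel_right₀ (pow_ne_zero _ hz), mul_left_comm,
    mul_div_mul_left _ _ h0]

end Invariants

/-! ### Lagrange resolvents of five numbers. -/

section Resolvents

variable {F : Type*} [Field F] {ζ : F} (hζ : 1 + ζ + ζ ^ 2 + ζ ^ 3 + ζ ^ 4 = 0)
include hζ

/-- With `p₁, p₂` the resolvents for `ζ, ζ²` and `τ` the exchange `b ↔ c`, `d ↔ e`, this is the
Möbius action of `τ` on `-p₁ / p₂` with denominators cleared. -/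
lemma resolvent_moebius [CharZero F] {a b c d e : F}
    (h1 : a + b + c + d + e = 0) (h2 : a ^ 2 + b ^ 2 + c ^ 2 + d ^ 2 + e ^ 2 = 0) :
    (a + ζ * c + ζ ^ 2 * b + ζ ^ 3 * e + ζ ^ 4 * d) *
      (-(ζ ^ 2 + ζ ^ 3) * (a + ζ ^ 2 * b + ζ ^ 4 * c + ζ * d + ζ ^ 3 * e) -
        (a + ζ * b + ζ ^ 2 * c + ζ ^ 3 * d + ζ ^ 4 * e)) +
    (a + ζ ^ 2 * c + ζ ^ 4 * b + ζ * e + ζ ^ 3 * d) *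
      ((a + ζ ^ 2 * b + ζ ^ 4 * c + ζ * d + ζ ^ 3 * e) +
        -(ζ ^ 2 + ζ ^ 3) * (a + ζ * b + ζ ^ 2 * c + ζ ^ 3 * d + ζ ^ 4 * e)) = 0 := by
  grind

/-- The last four hypotheses concern conjugates of a single resolvent, so that one resolvent cannot
vanish unless all five numbers do. -/
lemma eq_zero_of_resolvents_eq_zero [CharZero F] {a b c d e : F}
    (h1 : a + b + c + d + e = 0)
    (h2 : a + ζ ^ 2 * b + ζ ^ 4 * c + ζ * d + ζ ^ 3 * e = 0)
    (h3 : a + ζ ^ 2 * e + ζ ^ 4 * d + ζ * c + ζ ^ 3 * b = 0)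
    (h4 : a + ζ ^ 2 * c + ζ ^ 4 * b + ζ * e + ζ ^ 3 * d = 0)
    (h5 : a + ζ ^ 2 * d + ζ ^ 4 * e + ζ * b + ζ ^ 3 * c = 0) :
    a = 0 ∧ b = 0 ∧ c = 0 ∧ d = 0 ∧ e = 0 := by
  grind

end Resolvents

/-! ### Generators of `A₅` and its action on the roots. -/

/-- The order of the generated subgroup is divisible by 30, so its index is 1 or 2; a subgroup of
index 2 would be normal, contradicting simplicity. -/
lemma alternatingGroup_closure_eq_top {s t : alternatingGroup (Fin 5)}
    (hs : orderOf s = 5) (ht : orderOf t = 2) (hst : orderOf (s * t) = 3) :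
    Subgroup.closure {s, t} = ⊤ := by
  set H := Subgroup.closure {s, t}
  have hsH : s ∈ H := Subgroup.subset_closure (by simp)
  have htH : t ∈ H := Subgroup.subset_closure (by simp)
  have hcard : Nat.card (alternatingGroup (Fin 5)) = 60 := by
    rw [nat_card_alternatingGroup]; simp [Nat.factorial]
  have h5 : 5 ∣ Nat.card H := by
    simpa only [hs] using H.orderOf_dvd_natCard hsH
  have h2 : 2 ∣ Nat.card H := by
    simpa only [ht] using H.orderOf_dvd_natCard htH
  have h3 : 3 ∣ Nat.card H := by
    simpa only [hst] using H.orderOf_dvd_natCard (H.mul_mem hsH htH)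
  have hmul := H.card_mul_index
  rw [hcard] at hmul
  have h30 : 30 ∣ Nat.card H := by omega
  obtain ⟨k, hk⟩ := h30
  have hkle : k * H.index = 2 := by
    rw [hk, mul_assoc] at hmul; omega
  have hidx : H.index ∣ 2 := ⟨k, by rw [← hkle, mul_comm]⟩
  rcases (Nat.dvd_prime Nat.prime_two).1 hidx with h | h
  · exact Subgroup.index_eq_one.1 h
  · have := Subgroup.normal_of_index_eq_two h
    rcases this.eq_bot_or_eq_top with hb | ht'
    · rw [hb, Subgroup.card_bot] at h5
      omega
    · exact ht'

lemma exists_alternatingGroup_generators : ∃ s t u : alternatingGroup (Fin 5),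
    (∀ i, (s : Equiv.Perm (Fin 5)) i = ![1, 2, 3, 4, 0] i) ∧
    (∀ i, (t : Equiv.Perm (Fin 5)) i = ![0, 2, 1, 4, 3] i) ∧
    (∀ i, (u : Equiv.Perm (Fin 5)) i = ![0, 4, 3, 2, 1] i) ∧
    Subgroup.closure {s, t} = ⊤ := by
  let s : Equiv.Perm (Fin 5) := ⟨![1, 2, 3, 4, 0], ![4, 0, 1, 2, 3], by decide, by decide⟩
  let t : Equiv.Perm (Fin 5) := ⟨![0, 2, 1, 4, 3], ![0, 2, 1, 4, 3], by decide, by decide⟩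
  let u : Equiv.Perm (Fin 5) := ⟨![0, 4, 3, 2, 1], ![0, 4, 3, 2, 1], by decide, by decide⟩
  have hs : s ∈ alternatingGroup (Fin 5) := Equiv.Perm.mem_alternatingGroup.2 (by decide)
  have ht : t ∈ alternatingGroup (Fin 5) := Equiv.Perm.mem_alternatingGroup.2 (by decide)
  have hu : u ∈ alternatingGroup (Fin 5) := Equiv.Perm.mem_alternatingGroup.2 (by decide)
  have := Fact.mk Nat.prime_five
  refine ⟨⟨s, hs⟩, ⟨t, ht⟩, ⟨u, hu⟩, fun _ => rfl, fun _ => rfl, fun _ => rfl,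
    alternatingGroup_closure_eq_top ?_ ?_ ?_⟩
  · rw [Subgroup.orderOf_mk]
    exact orderOf_eq_prime (by decide) (by decide)
  · rw [Subgroup.orderOf_mk]
    exact orderOf_eq_prime (by decide) (by decide)
  · rw [MulMemClass.mk_mul_mk, Subgroup.orderOf_mk]
    exact orderOf_eq_prime (by decide) (by decide)

lemma exists_mulEquiv_alternatingGroup {K L : Type*} [Field K] [Field L] [Algebra K L]
    {g : K[X]} (hdeg : g.natDegree = 5) [hsplit : IsSplittingField K L g]
    (hcard : Nat.card (L ≃ₐ[K] L) = 60) :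
    ∃ x : Fin 5 → L, Function.Injective x ∧ (∀ i, aeval (x i) g = 0) ∧
      ∃ ρ : (L ≃ₐ[K] L) ≃* alternatingGroup (Fin 5),
        ∀ σ i, σ (x i) = x ((ρ σ : Equiv.Perm (Fin 5)) i) := by
  classical
  have hinj : Function.Injective (MulAction.toPermHom (L ≃ₐ[K] L) (g.rootSet L)) := by
    intro σ τ h
    have : (σ : L →ₐ[K] L) = τ := by
      refine AlgHom.ext_of_adjoin_eq_top hsplit.adjoin_rootSet fun r hr => ?_
      have := congrArg Subtype.val (DFunLike.congr_fun h ⟨r, hr⟩)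
      simpa using this
    exact AlgEquiv.ext fun a => DFunLike.congr_fun this a
  have hle : Nat.card (g.rootSet L) ≤ 5 := by
    rw [← hdeg, Nat.card_coe_set_eq]
    exact g.ncard_rootSet_le L
  -- A faithful action on at most five roots by a group of order 60 forces exactly five, and the
  -- image has index 2 in `S₅`.
  have hdvd : 60 ∣ (Nat.card (g.rootSet L)).factorial := by
    rw [← hcard, ← Nat.card_perm]
    exact Subgroup.card_dvd_of_injective _ hinj
  have h5 : Nat.card (g.rootSet L) = 5 := by
    generalize Nat.card (g.rootSet L) = n at hle hdvd
    interval_cases n <;> simp_all [Nat.factorial]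
  have e : g.rootSet L ≃ Fin 5 := Finite.equivFinOfCardEq h5
  let ρ₀ : (L ≃ₐ[K] L) →* Equiv.Perm (Fin 5) :=
    e.permCongrHom.toMonoidHom.comp (MulAction.toPermHom (L ≃ₐ[K] L) (g.rootSet L))
  have hρ₀ : Function.Injective ρ₀ := e.permCongrHom.injective.comp hinj
  have hrange : ρ₀.range = alternatingGroup (Fin 5) := by
    apply Equiv.Perm.eq_alternatingGroup_of_index_eq_two
    have h := ρ₀.range.card_mul_index
    rw [← Nat.card_congr (MonoidHom.ofInjective hρ₀).toEquiv, hcard, Nat.card_perm] at h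
    simp [Nat.factorial] at h
    omega
  refine ⟨fun i => (e.symm i : L), Subtype.val_injective.comp e.symm.injective,
    fun i => aeval_eq_zero_of_mem_rootSet (e.symm i).2,
    (MonoidHom.ofInjective hρ₀).trans (MulEquiv.subgroupCongr hrange), fun σ i => ?_⟩
  change σ (e.symm i) = (e.symm (ρ₀ σ i) : L)
  simp [ρ₀]

/-! ### Galois theory checked on generators of the group. -/

section Generation

variable {K L : Type*} [Field K] [Field L] [Algebra K L] [FiniteDimensional K L] [IsGalois K L]
  {S : Set (L ≃ₐ[K] L)} (hS : Subgroup.closure S = ⊤)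
include hS

open IntermediateField

lemma mem_bot_of_forall_generator {a : L} (ha : ∀ σ ∈ S, σ a = a) :
    a ∈ (⊥ : IntermediateField K L) := by
  rw [IsGalois.mem_bot_iff_fixed]
  intro σ
  have : Subgroup.closure S ≤ MulAction.stabilizer (L ≃ₐ[K] L) a :=
    (Subgroup.closure_le _).2 ha
  rw [hS] at this
  exact this (Subgroup.mem_top σ)

lemma isGalois_adjoin_of_forall_generator {a : L} (ha : ∀ σ ∈ S, σ a ∈ K⟮a⟯) :
    IsGalois K K⟮a⟯ := by
  have key : ∀ σ : L ≃ₐ[K] L, K⟮a⟯.map (σ : L →ₐ[K] L) ≤ K⟮a⟯ := by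
    intro σ
    have hσ : σ ∈ Submonoid.closure S := by
      rw [← Subgroup.closure_toSubmonoid_of_finite, hS]
      trivial
    induction hσ using Submonoid.closure_induction with
    | mem σ h =>
      rw [adjoin_map, adjoin_le_iff]
      simpa using ha σ h
    | one =>
      rintro _ ⟨b, hb, rfl⟩
      exact hb
    | mul σ τ _ _ h₁ h₂ =>
      rintro _ ⟨b, hb, rfl⟩
      exact h₁ ⟨τ b, h₂ ⟨b, hb, rfl⟩, rfl⟩
  have : Normal K K⟮a⟯ := normal_iff_forall_map_le'.2 key
  exact ⟨⟩

lemma adjoin_eq_bot_or_top [IsSimpleGroup (L ≃ₐ[K] L)] {a : L} (ha : ∀ σ ∈ S, σ a ∈ K⟮a⟯) :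
    K⟮a⟯ = ⊥ ∨ K⟮a⟯ = ⊤ := by
  have := isGalois_adjoin_of_forall_generator hS ha
  rw [← IsGalois.fixedField_fixingSubgroup K⟮a⟯]
  rcases (inferInstance : K⟮a⟯.fixingSubgroup.Normal).eq_bot_or_eq_top with h | h
  · exact Or.inr (by rw [h, fixedField_bot])
  · exact Or.inl (by rw [h, IsGalois.fixedField_top])

end Generation

/-! ### Reduction to a principal quintic. -/

section PrincipalQuintic

variable {K L : Type*} [Field K] [Field L] [Algebra K L]

lemma map_eq_prod_X_sub_C {g : K[X]} (hmonic : g.Monic) (hdeg : g.natDegree = 5) {x : Fin 5 → L}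
    (hx : Function.Injective x) (hroot : ∀ i, aeval (x i) g = 0) :
    g.map (algebraMap K L) = ∏ i, (X - C (x i)) := by
  rw [← sub_eq_zero]
  refine eq_zero_of_natDegree_lt_card_of_eval_eq_zero _ hx (fun i => ?_) ?_
  · rw [eval_sub, eval_map_algebraMap, hroot, eval_prod,
      Finset.prod_eq_zero (Finset.mem_univ i) (by simp), sub_zero]
  · rw [Fintype.card_fin]
    refine IsMonicOfDegree.natDegree_sub_lt (by norm_num)
      ⟨by rw [natDegree_map, hdeg], hmonic.map _⟩ ⟨?_, monic_prod_X_sub_C _ _⟩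
    rw [natDegree_finsetProd_X_sub_C_eq_card]
    simp

lemma coeff_prod_X_sub_C (z : Fin 5 → L) :
    (∏ i, (X - C (z i))).coeff 4 = -(z 0 + z 1 + z 2 + z 3 + z 4) ∧
    (∏ i, (X - C (z i))).coeff 3 = z 0 * z 1 + z 0 * z 2 + z 0 * z 3 + z 0 * z 4 + z 1 * z 2 +
      z 1 * z 3 + z 1 * z 4 + z 2 * z 3 + z 2 * z 4 + z 3 * z 4 ∧
    (∏ i, (X - C (z i))).coeff 2 = -(z 0 * z 1 * z 2 + z 0 * z 1 * z 3 + z 0 * z 1 * z 4 +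
      z 0 * z 2 * z 3 + z 0 * z 2 * z 4 + z 0 * z 3 * z 4 + z 1 * z 2 * z 3 + z 1 * z 2 * z 4 +
      z 1 * z 3 * z 4 + z 2 * z 3 * z 4) ∧
    (∏ i, (X - C (z i))).coeff 1 = z 0 * z 1 * z 2 * z 3 + z 0 * z 1 * z 2 * z 4 +
      z 0 * z 1 * z 3 * z 4 + z 0 * z 2 * z 3 * z 4 + z 1 * z 2 * z 3 * z 4 := by
  have h : ∏ i, (X - C (z i)) = X ^ 5 + C (-(z 0 + z 1 + z 2 + z 3 + z 4)) * X ^ 4 +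
      C (z 0 * z 1 + z 0 * z 2 + z 0 * z 3 + z 0 * z 4 + z 1 * z 2 +
      z 1 * z 3 + z 1 * z 4 + z 2 * z 3 + z 2 * z 4 + z 3 * z 4) * X ^ 3 +
      C (-(z 0 * z 1 * z 2 + z 0 * z 1 * z 3 + z 0 * z 1 * z 4 +
      z 0 * z 2 * z 3 + z 0 * z 2 * z 4 + z 0 * z 3 * z 4 + z 1 * z 2 * z 3 + z 1 * z 2 * z 4 +
      z 1 * z 3 * z 4 + z 2 * z 3 * z 4)) * X ^ 2 +
      C (z 0 * z 1 * z 2 * z 3 + z 0 * z 1 * z 2 * z 4 +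
      z 0 * z 1 * z 3 * z 4 + z 0 * z 2 * z 3 * z 4 + z 1 * z 2 * z 3 * z 4) * X +
      C (-(z 0 * z 1 * z 2 * z 3 * z 4)) := by
    simp only [Fin.prod_univ_five, map_add, map_mul, map_neg]
    ring
  rw [h]
  simp only [coeff_add, coeff_C_mul, coeff_X_pow, coeff_X, coeff_C]
  norm_num

lemma map_depressed {g : K[X]} {x : Fin 5 → L}
    (hg : g.map (algebraMap K L) = ∏ i, (X - C (x i))) :
    (depressed g).map (algebraMap K L) =
      ∏ i, (X - C (x i + algebraMap K L (g.coeff 4 / 5))) := by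
  rw [depressed, Polynomial.map_comp, hg, prod_comp]
  refine Finset.prod_congr rfl fun i _ => ?_
  simp only [Polynomial.map_sub, map_X, map_C, sub_comp, X_comp, C_comp, map_add]
  ring

lemma exists_principal_polynomial [CharZero K] {g : K[X]} (hmonic : g.Monic)
    (hdeg : g.natDegree = 5) {x : Fin 5 → L}
    (hx : Function.Injective x) (hroot : ∀ i, aeval (x i) g = 0)
    (hδ : (depressed g).coeff 3 ≠ 0 → ∃ δ : K, IsTschirnhausIrrationality g δ) :
    ∃ h : K[X], ∑ i, aeval (x i) h = 0 ∧ ∑ i, aeval (x i) h ^ 2 = 0 ∧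
      ∃ i, aeval (x i) h ≠ 0 := by
  have : CharZero L := charZero_of_injective_algebraMap (algebraMap K L).injective
  have hg := map_eq_prod_X_sub_C hmonic hdeg hx hroot
  set m := algebraMap K L (g.coeff 4 / 5) with hm
  obtain ⟨-, c3, c2, c1⟩ := coeff_prod_X_sub_C (fun i => x i + m)
  rw [← map_depressed hg, coeff_map] at c1 c2 c3
  obtain ⟨c4, -⟩ := coeff_prod_X_sub_C x
  rw [← hg, coeff_map] at c4
  have hsum : (x 0 + m) + (x 1 + m) + (x 2 + m) + (x 3 + m) + (x 4 + m) = 0 := by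
    rw [hm, map_div₀, c4, map_ofNat]
    ring
  have hne : ∀ h : K[X], h.Monic → h.natDegree < 5 → ∃ i, aeval (x i) h ≠ 0 := by
    intro h hh hd
    by_contra! hz
    refine (hh.map (algebraMap K L)).ne_zero
      (eq_zero_of_natDegree_lt_card_of_eval_eq_zero _ hx (fun i => ?_) ?_)
    · rw [eval_map_algebraMap, hz]
    · rwa [natDegree_map, Fintype.card_fin]
  generalize hp : (depressed g).coeff 3 = p at *
  generalize hq : (depressed g).coeff 2 = q at *
  generalize hr : (depressed g).coeff 1 = r at *
  by_cases hp0 : p = 0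
  · refine ⟨X + C (g.coeff 4 / 5), ?_, ?_, hne _ (monic_X_add_C _) (by simp)⟩
    · simpa [Fin.sum_univ_five, ← hm] using hsum
    · rw [hp0, map_zero] at c3
      simp only [map_add, aeval_X, aeval_C, ← hm, Fin.sum_univ_five]
      generalize x 0 + m = z₀ at *
      generalize x 1 + m = z₁ at *
      generalize x 2 + m = z₂ at *
      generalize x 3 + m = z₃ at *
      generalize x 4 + m = z₄ at *
      linear_combination (z₀ + z₁ + z₂ + z₃ + z₄) * hsum + 2 * c3
  · obtain ⟨δ, hδ⟩ := hδ hp0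
    simp only [IsTschirnhausIrrationality, hp, hq, hr] at hδ
    -- For `y = z² + α z + 2p/5` the constant makes `∑ y = 0`, since `∑ z² = -2p`. Then `∑ y²` is
    -- `-2/5` times the quadratic in `α` below, which `δ` solves.
    obtain ⟨α, hα⟩ : ∃ α, α = δ - 3 * q / (2 * p) := ⟨_, rfl⟩
    have hα' : 5 * p * α ^ 2 + 15 * q * α - 3 * p ^ 2 + 10 * r = 0 := by
      rw [hα]
      field_simp at hδ ⊢
      linear_combination hδ
    refine ⟨(X + C (g.coeff 4 / 5)) ^ 2 + C α * (X + C (g.coeff 4 / 5)) + C (2 * p / 5),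
      ?_, ?_, hne _ ?_ ?_⟩
    · simp only [map_add, map_mul, map_pow, aeval_X, aeval_C, ← hm, Fin.sum_univ_five, map_div₀,
        map_ofNat]
      generalize x 0 + m = z₀ at *
      generalize x 1 + m = z₁ at *
      generalize x 2 + m = z₂ at *
      generalize x 3 + m = z₃ at *
      generalize x 4 + m = z₄ at *
      linear_combination (z₀ + z₁ + z₂ + z₃ + z₄ + algebraMap K L α) * hsum + 2 * c3
    · replace hα' := congrArg (algebraMap K L) hα'
      simp only [map_add, map_sub, map_mul, map_pow, map_ofNat, map_zero] at hα'
      simp only [map_add, map_mul, map_pow, aeval_X, aeval_C, ← hm, Fin.sum_univ_five, map_div₀,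
        map_ofNat]
      generalize x 0 + m = z₀ at *
      generalize x 1 + m = z₁ at *
      generalize x 2 + m = z₂ at *
      generalize x 3 + m = z₃ at *
      generalize x 4 + m = z₄ at *
      generalize algebraMap K L α = a at *
      obtain rfl : z₄ = -(z₀ + z₁ + z₂ + z₃) := by linear_combination hsum
      rw [c3, c2, c1] at hα'
      rw [c3]
      linear_combination (-2 / 5) * hα'
    · monicity!
    · compute_degree!
end PrincipalQuintic

section Map

variable {A B : Type*}

lemma map_formF [CommRing A] [CommRing B] (f : A →+* B) (z w : A) :
    f (formF z w) = formF (f z) (f w) := by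
  simp only [formF, map_mul, map_add, map_sub, map_pow, map_ofNat]

lemma map_formH [CommRing A] [CommRing B] (f : A →+* B) (z w : A) :
    f (formH z w) = formH (f z) (f w) := by
  simp only [formH, map_mul, map_add, map_sub, map_neg, map_pow, map_ofNat]

lemma map_invariant [Field A] [Field B] (f : A →+* B) (z : A) :
    f (invariant z) = invariant (f z) := by
  simp only [invariant, map_div₀, map_mul, map_pow, map_ofNat, map_formF, map_formH, map_one]

end Map

/-! ### The icosahedral parameter and its field. -/

section Parameter

open IntermediateField

variable {K L : Type*} [Field K] [Field L] [Algebra K L]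

lemma exists_generators_moebius [CharZero L] {ζ : K}
    (hζ : 1 + ζ + ζ ^ 2 + ζ ^ 3 + ζ ^ 4 = 0) {y : Fin 5 → L}
    (ρ : (L ≃ₐ[K] L) ≃* alternatingGroup (Fin 5))
    (hρ : ∀ σ i, σ (y i) = y ((ρ σ : Equiv.Perm (Fin 5)) i))
    (h1 : ∑ i, y i = 0) (h2 : ∑ i, y i ^ 2 = 0) (h0 : ∃ i, y i ≠ 0) :
    ∃ (Y : L) (σ τ : L ≃ₐ[K] L), Subgroup.closure {σ, τ} = ⊤ ∧ σ Y = algebraMap K L ζ * Y ∧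
      Y + algebraMap K L (-(ζ ^ 2 + ζ ^ 3)) ≠ 0 ∧
      τ Y = (1 - algebraMap K L (-(ζ ^ 2 + ζ ^ 3)) * Y) /
        (Y + algebraMap K L (-(ζ ^ 2 + ζ ^ 3))) := by
  obtain ⟨s, t, u, hs, ht, hu, hgen⟩ := exists_alternatingGroup_generators
  obtain ⟨σ, rfl⟩ := ρ.surjective s
  obtain ⟨τ, rfl⟩ := ρ.surjective t
  obtain ⟨υ, rfl⟩ := ρ.surjective u
  have hs' : ∀ i, σ (y i) = y (![1, 2, 3, 4, 0] i) := fun i => by rw [hρ, hs]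
  have ht' : ∀ i, τ (y i) = y (![0, 2, 1, 4, 3] i) := fun i => by rw [hρ, ht]
  have hu' : ∀ i, υ (y i) = y (![0, 4, 3, 2, 1] i) := fun i => by rw [hρ, hu]
  have hclosure : Subgroup.closure {σ, τ} = ⊤ := by
    apply Subgroup.map_injective ρ.injective (f := ρ.toMonoidHom)
    rw [MonoidHom.map_closure, Subgroup.map_top_of_surjective _ ρ.surjective, ← hgen]
    simp [Set.image_pair]
  simp only [Fin.sum_univ_five] at h1 h2
  obtain ⟨z, hz⟩ : ∃ z, z = algebraMap K L ζ := ⟨_, rfl⟩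
  have hzz : 1 + z + z ^ 2 + z ^ 3 + z ^ 4 = 0 := by
    simpa [hz] using congrArg (algebraMap K L) hζ
  have hfix : ∀ κ : L ≃ₐ[K] L, κ z = z := fun κ => by rw [hz, κ.commutes]
  have hφ : algebraMap K L (-(ζ ^ 2 + ζ ^ 3)) = -(z ^ 2 + z ^ 3) := by simp [hz]
  have hz5 : z ^ 5 = 1 := by linear_combination (z - 1) * hzz
  have hz0 : z ≠ 0 := by rintro rfl; simp at hz5
  obtain ⟨p₁, hp₁⟩ : ∃ p, p = y 0 + z * y 1 + z ^ 2 * y 2 + z ^ 3 * y 3 + z ^ 4 * y 4 := ⟨_, rfl⟩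
  obtain ⟨p₂, hp₂⟩ : ∃ p, p = y 0 + z ^ 2 * y 1 + z ^ 4 * y 2 + z * y 3 + z ^ 3 * y 4 := ⟨_, rfl⟩
  have hτ₁ : τ p₁ = y 0 + z * y 2 + z ^ 2 * y 1 + z ^ 3 * y 4 + z ^ 4 * y 3 := by
    simp [hp₁, hfix, ht']
  have hτ₂ : τ p₂ = y 0 + z ^ 2 * y 2 + z ^ 4 * y 1 + z * y 4 + z ^ 3 * y 3 := by
    simp [hp₂, hfix, ht']
  have hυ₂ : υ p₂ = y 0 + z ^ 2 * y 4 + z ^ 4 * y 3 + z * y 2 + z ^ 3 * y 1 := by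
    simp [hp₂, hfix, hu']
  have hτυ₂ : τ (υ p₂) = y 0 + z ^ 2 * y 3 + z ^ 4 * y 4 + z * y 1 + z ^ 3 * y 2 := by
    simp [hυ₂, hfix, ht']
  -- If `p₂` vanished, so would its images under `υ`, `τ` and `τ υ`, and with them every `y i`.
  have hp0 : p₂ ≠ 0 := by
    intro h
    simp only [h, map_zero] at hp₂ hτ₂ hυ₂ hτυ₂
    obtain ⟨e0, e1, e2, e3, e4⟩ :=
      eq_zero_of_resolvents_eq_zero hzz h1 hp₂.symm hυ₂.symm hτ₂.symm hτυ₂.symm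
    obtain ⟨i, hi⟩ := h0
    fin_cases i
    exacts [hi e0, hi e1, hi e2, hi e3, hi e4]
  have hτp0 : τ p₂ ≠ 0 := by simpa using hp0
  have key : τ p₁ * (-(z ^ 2 + z ^ 3) * p₂ - p₁) + τ p₂ * (p₂ + -(z ^ 2 + z ^ 3) * p₁) = 0 := by
    rw [hτ₁, hτ₂, hp₁, hp₂]
    exact resolvent_moebius hzz h1 h2
  -- With `φ = -(z² + z³)`, a zero denominator means `p₁ = φ p₂`, and `key` gives `(1 + φ²) p₂ = 0`.
  -- But `(3 - φ)(1 + φ²) = 5`.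
  have hden : -p₁ / p₂ + -(z ^ 2 + z ^ 3) ≠ 0 := by
    intro h
    field_simp at h
    have h' : p₁ = -(z ^ 2 + z ^ 3) * p₂ := by linear_combination -h
    rw [h', sub_self, mul_zero, zero_add, mul_eq_zero, or_iff_right hτp0] at key
    have hw : (z ^ 2 + z ^ 3) ^ 2 = 1 - (z ^ 2 + z ^ 3) := by
      linear_combination (z ^ 2 + z - 1) * hzz
    have h5 : (5 : L) * p₂ = 0 := by
      generalize z ^ 2 + z ^ 3 = w at key hw
      linear_combination (3 + w) * key - (w + 2) * p₂ * hw
    exact mul_ne_zero (by norm_num) hp0 h5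
  refine ⟨-p₁ / p₂, σ, τ, hclosure, ?_, ?_, ?_⟩
  · have hσ₁ : z * σ p₁ = p₁ := by
      simp only [hp₁, map_add, map_mul, map_pow, hfix, hs']
      simp
      linear_combination y 0 * hz5
    have hσ₂ : z ^ 2 * σ p₂ = p₂ := by
      simp only [hp₂, map_add, map_mul, map_pow, hfix, hs']
      simp
      linear_combination (z * y 3 + y 0) * hz5
    have hσp0 : σ p₂ ≠ 0 := by simpa using hp0
    rw [map_div₀, map_neg, ← hz]
    nth_rw 2 [← hσ₁]
    nth_rw 2 [← hσ₂]
    field_simp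
  · rwa [hφ]
  · rw [hφ, map_div₀, map_neg, eq_div_iff hden]
    field_simp
    linear_combination -key

theorem exists_primitive_invariant_mem [CharZero K] [FiniteDimensional K L] [IsGalois K L]
    {ζ : K} (hζ : 1 + ζ + ζ ^ 2 + ζ ^ 3 + ζ ^ 4 = 0)
    (e : (L ≃ₐ[K] L) ≃* alternatingGroup (Fin 5)) {g : K[X]} (hmonic : g.Monic)
    (hdeg : g.natDegree = 5) [IsSplittingField K L g]
    (hδ : (depressed g).coeff 3 ≠ 0 → ∃ δ : K, IsTschirnhausIrrationality g δ) :
    ∃ Y : L, K⟮Y⟯ = ⊤ ∧ ∃ J : K, algebraMap K L J = invariant Y := by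
  have : CharZero L := charZero_of_injective_algebraMap (algebraMap K L).injective
  have : IsSimpleGroup (L ≃ₐ[K] L) := e.isSimpleGroup
  have hcard : Nat.card (L ≃ₐ[K] L) = 60 := by
    rw [Nat.card_congr e.toEquiv, nat_card_alternatingGroup]
    simp [Nat.factorial]
  obtain ⟨x, hx, hroot, ρ, hρ⟩ := exists_mulEquiv_alternatingGroup hdeg hcard
  obtain ⟨h, h1, h2, h0⟩ := exists_principal_polynomial hmonic hdeg hx hroot hδ
  obtain ⟨Y, σ, τ, hgen, hσ, hY, hτ⟩ := exists_generators_moebius hζ (y := fun i => aeval (x i) h) ρ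
    (fun σ i => by rw [← hρ, ← AlgEquiv.coe_toAlgHom, ← aeval_algHom_apply]) h1 h2 h0
  obtain ⟨φ, hφ⟩ : ∃ φ, φ = -(ζ ^ 2 + ζ ^ 3) := ⟨_, rfl⟩
  rw [← hφ] at hY hτ
  have hφ2 : φ ^ 2 = φ + 1 := by
    rw [hφ]
    linear_combination (ζ ^ 2 + ζ - 1) * hζ
  have hφ0 : φ ≠ 0 := by
    intro h
    norm_num [h] at hφ2
  have hζ5 : ζ ^ 5 = 1 := by linear_combination (ζ - 1) * hζ
  have hζ1 : ζ ≠ 1 := by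
    rintro rfl
    norm_num at hζ
  have hYmem : Y ∈ K⟮Y⟯ := mem_adjoin_simple_self K Y
  refine ⟨Y, ?_, ?_⟩
  · refine (adjoin_eq_bot_or_top hgen ?_).resolve_left ?_
    · rintro κ (rfl | rfl)
      · rw [hσ]
        exact mul_mem (IntermediateField.algebraMap_mem _ _) hYmem
      · rw [hτ]
        exact div_mem (sub_mem (one_mem _) (mul_mem (IntermediateField.algebraMap_mem _ _) hYmem))
          (add_mem hYmem (IntermediateField.algebraMap_mem _ _))
    -- If `Y` were in `K`, the rotation would force `Y = 0`, which `τ` sends to `1 / φ ≠ 0`.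
    · intro hbot
      rw [adjoin_simple_eq_bot_iff, IsGalois.mem_bot_iff_fixed] at hbot
      have hY0 : Y = 0 := by
        rw [hbot] at hσ
        have h : (algebraMap K L ζ - 1) * Y = 0 := by linear_combination -hσ
        refine (mul_eq_zero.1 h).resolve_left fun h => hζ1 ?_
        apply (algebraMap K L).injective
        rw [map_one, sub_eq_zero.1 h]
      rw [hbot, hY0] at hτ
      simp only [mul_zero, sub_zero, zero_add] at hτ
      exact one_div_ne_zero ((_root_.map_ne_zero _).2 hφ0) hτ.symm
  · have hmap (κ : L ≃ₐ[K] L) : κ (invariant Y) = invariant (κ Y) := map_invariant (κ : L →+* L) Y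
    have hmem : invariant Y ∈ (⊥ : IntermediateField K L) := by
      refine mem_bot_of_forall_generator hgen ?_
      rintro κ (rfl | rfl)
      · rw [hmap, hσ, invariant_rotation (by rw [← map_pow, hζ5, map_one])]
      · rw [hmap, hτ, invariant_moebius _ hY]
        rw [← map_pow, hφ2, map_add, map_one]
    exact mem_bot.1 hmem

end Parameter

/-! ### The icosahedral equation as a polynomial of degree 60. -/

section Equation

variable {K : Type*} [Field K]

/-- The degree is 11, not 12, because one vertex lies at infinity. Hence `f⁵` has degree 55 and
cannot affect the leading term of `H³`. -/
lemma natDegree_formF : (formF (X : K[X]) 1).natDegree = 11 := by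
  unfold formF
  compute_degree!

lemma natDegree_formH : (formH (X : K[X]) 1).natDegree = 20 := by
  simp only [formH, one_pow, mul_one]
  compute_degree!
  simp [coeff_one]

/-- The polynomial obtained from the icosahedral equation by clearing denominators. -/
noncomputable def equationPolynomial (J : K) : K[X] :=
  formH X 1 ^ 3 - C (1728 * J) * formF X 1 ^ 5

lemma natDegree_equationPolynomial (J : K) : (equationPolynomial J).natDegree = 60 := by
  have h : (formH (X : K[X]) 1 ^ 3).natDegree = 60 := by
    rw [natDegree_pow, natDegree_formH]
  rw [equationPolynomial, natDegree_sub_eq_left_of_natDegree_lt, h]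
  rw [h]
  refine (natDegree_C_mul_le _ _).trans_lt ?_
  rw [natDegree_pow, natDegree_formF]
  norm_num

variable {E : Type*} [Field E] [Algebra K E]

lemma aeval_formF (Y : E) : aeval Y (formF (X : K[X]) 1) = formF Y 1 := by
  simpa using map_formF (aeval (R := K) Y).toRingHom X 1

lemma aeval_formH (Y : E) : aeval Y (formH (X : K[X]) 1) = formH Y 1 := by
  simpa using map_formH (aeval (R := K) Y).toRingHom X 1

lemma aeval_equationPolynomial [CharZero E] {J : K} {Y : E} (hY : formF Y 1 ≠ 0) :
    aeval Y (equationPolynomial J) = 0 ↔ invariant Y = algebraMap K E J := by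
  have h : (1728 * formF Y 1 ^ 5 : E) ≠ 0 := mul_ne_zero (by norm_num) (pow_ne_zero _ hY)
  rw [invariant, div_eq_iff h, equationPolynomial, map_sub, map_mul, map_pow, map_pow,
    aeval_formF, aeval_formH, aeval_C, map_mul, map_ofNat, sub_eq_zero, mul_left_comm, mul_assoc]

end Equation

end Icosahedral

/-! ### Conjugacy of all solutions. -/

open Icosahedral IntermediateField in
theorem mainTheorem1
    (K : Subfield ℂ)
    (hζ : ∀ ζ : ℂ, ζ ^ 5 = 1 → ζ ∈ K)
    (L : IntermediateField K ℂ)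
    (hL : IsGalois K L)
    (hA₅ : Nonempty ((L ≃ₐ[K] L) ≃* alternatingGroup (Fin 5)))
    (g : Polynomial K)
    (hmonic : g.Monic)
    (hdeg : g.natDegree = 5)
    (hsplit : Polynomial.IsSplittingField K L g)
    (hδ : (Icosahedral.depressed g).coeff 3 ≠ 0 →
      ∃ δ : K, Icosahedral.IsTschirnhausIrrationality g δ) :
    ∃ J : K, (∃ Y : ℂ, Icosahedral.IsSolution (J : ℂ) Y) ∧
      ∀ Y : ℂ, Icosahedral.IsSolution (J : ℂ) Y → IntermediateField.adjoin K {Y} = L := by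
  obtain ⟨e⟩ := hA₅
  have : FiniteDimensional K L := IsSplittingField.finiteDimensional L g
  have hrank : Module.finrank K L = 60 := by
    rw [← IsGalois.card_aut_eq_finrank, Nat.card_congr e.toEquiv, nat_card_alternatingGroup]
    simp [Nat.factorial]
  obtain ⟨ζ, hprim⟩ : ∃ ζ : ℂ, IsPrimitiveRoot ζ 5 :=
    ⟨_, Complex.isPrimitiveRoot_exp 5 (by norm_num)⟩
  have hsum : 1 + ζ + ζ ^ 2 + ζ ^ 3 + ζ ^ 4 = 0 := by
    simpa [Finset.sum_range_succ] using hprim.geom_sum_eq_zero (by norm_num)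
  obtain ⟨Y, hY, J, hJ⟩ := exists_primitive_invariant_mem (ζ := ⟨ζ, hζ ζ hprim.pow_eq_one⟩)
    (by apply Subtype.ext; simpa using hsum) e hmonic hdeg hδ
  have hadj : K⟮(Y : ℂ)⟯ = L := by
    rw [← lift_adjoin_simple, hY, lift_top]
  have hint : ∀ Z : ℂ, Z ∈ L → IsIntegral K Z := fun Z hZ =>
    (IsGalois.integral K (⟨Z, hZ⟩ : L)).map L.val
  have hYint := hint Y Y.2
  have hmin : (minpoly K (Y : ℂ)).natDegree = 60 := by
    rw [← adjoin.finrank hYint, hadj, hrank]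
  -- A number of degree 60 is not a root of a nonzero polynomial of degree 11.
  have hF : formF (Y : ℂ) 1 ≠ 0 := by
    intro h
    have hne : formF (X : K[X]) 1 ≠ 0 := ne_zero_of_natDegree_gt (n := 0) (by simp [natDegree_formF])
    have := natDegree_le_of_dvd (minpoly.dvd K (Y : ℂ) (by rw [aeval_formF, h])) hne
    rw [hmin, natDegree_formF] at this
    omega
  have hinv : invariant (Y : ℂ) = J := by
    have := congrArg (algebraMap L ℂ) hJ
    rw [map_invariant] at this
    exact this.symm
  refine ⟨J, ⟨Y, hF, hinv⟩, fun Z ⟨hZF, hZ⟩ => ?_⟩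
  have hroot : aeval (Y : ℂ) (equationPolynomial J) = 0 := (aeval_equationPolynomial hF).2 hinv
  have hrootZ : aeval Z (equationPolynomial J) = 0 := (aeval_equationPolynomial hZF).2 hZ
  have hP0 : equationPolynomial J ≠ 0 :=
    ne_zero_of_natDegree_gt (n := 0) (by simp [natDegree_equationPolynomial])
  -- Only associated, not equal: `equationPolynomial J` has leading coefficient `-1`.
  have hassoc : Associated (minpoly K (Y : ℂ)) (equationPolynomial J) :=
    associated_of_dvd_of_natDegree_le (minpoly.dvd K _ hroot) hP0
      (by rw [hmin, natDegree_equationPolynomial])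
  have hminZ : minpoly K (Y : ℂ) = minpoly K Z := by
    refine minpoly.eq_of_irreducible_of_monic (minpoly.irreducible hYint) ?_ (minpoly.monic hYint)
    obtain ⟨c, hc⟩ := hassoc.symm.dvd
    rw [hc, map_mul, hrootZ, zero_mul]
  have hZL : Z ∈ L := by
    have hs : ((minpoly K Y).map (algebraMap K L)).Splits := hL.to_normal.splits Y
    rw [← minpoly.algebraMap_eq (algebraMap L ℂ).injective] at hs
    obtain ⟨w, rfl⟩ : Z ∈ (algebraMap L ℂ).range := by
      refine hs.mem_range_of_isRoot ((minpoly.monic hYint).map _).ne_zero ?_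
      rw [Polynomial.map_map, ← IsScalarTower.algebraMap_eq, IsRoot, eval_map_algebraMap]
      exact hminZ ▸ minpoly.aeval K Z
    exact w.2
  refine eq_of_le_of_finrank_eq (adjoin_simple_le_iff.2 hZL) ?_
  rw [adjoin.finrank (hint Z hZL), ← hminZ, hmin, hrank]
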